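/- For $A\in M_n(\mathbb C)$ and $1\le k\le n$ let $$\Lambda_k(A)=\{\lambda\in\mathbb C:\ PAP=\lambda P\ \text{for some orthogonal projection } P \text{ of rank } k\}$$ be the rank-$k$ numerical range of $A$. Let $0<r<n\le 2r$ and let $$A=\begin{bmatrix}\alpha I_r & C\\ D&\beta I_{n-r}\end{bmatrix}\in M_n(\mathbb C),\qquad \alpha,\beta\in\mathbb C,$$ be such that $Z=DC$ is normal and commutes with $H=C^*C+DD^*$. Let $U$ be any unitary matrix diagonalizing both, $U^*ZU=\mathrm{diag}(z_1,\dots,z_{n-r})$ and $U^*HU=\mathrm{diag}(h_1,\dots,h_{n-r})$. For $1\le j\le n-r$ put $\Delta_j=(\alpha-\beta)^2+4z_j$ and let $\mathcal E_j$ be the closed elliptical disc with foci $\tfrac12(\alpha+\beta)\pm\tfrac12\sqrt{\Delta_j}$ and with major and minor axes of lengths $$\sqrt{\tfrac12|\alpha-\beta|^2+h_j+\tfrac12|\Delta_j|}\qquad\text{and}\qquad \sqrt{\tfrac12|\alpha-\beta|^2+h_j-\tfrac12|\Delta_j|},$$ respectively, that is, the set of points of $\mathbb C$ whose distances to the two foci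 add up to at most the length of the major axis (the segment joining the foci, possibly a single point, if the minor axis has length $0$). If $\mathcal E_{n-r}\subseteq\cdots\subseteq\mathcal E_1$, then $$\Lambda_k(A)=\mathcal E_k,\qquad 1\le k\le n-r.$$ -/

import Mathlib

open scoped Matrix

noncomputable section

/-- The rank-`k` numerical range of a complex matrix `A`: all `c` such that `P A P = c P` for some
orthogonal projection `P` of rank `k`. -/
def rankNumericalRange {ι : Type*} [Fintype ι] [DecidableEq ι] (k : ℕ) (A : Matrix ι ι ℂ) : Set ℂ :=
  {c | ∃ P : Matrix ι ι ℂ, P.IsHermitian ∧ P * P = P ∧ P.rank = k ∧ P * A * P = c • P}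

/-- The closed elliptical disc with foci `f₁`, `f₂` and major axis of length `a`. It is the segment
joining the foci if `a` is the distance between them. -/
def ellipticalDisc (f₁ f₂ : ℂ) (a : ℝ) : Set ℂ :=
  {z | dist z f₁ + dist z f₂ ≤ a}

/-- The length of the minor axis of the ellipse with foci `f₁`, `f₂` and major axis of
length `a`. -/
def minorAxisLength (f₁ f₂ : ℂ) (a : ℝ) : ℝ :=
  √(a ^ 2 - dist f₁ f₂ ^ 2)

/-- The number `Δ = (α - β)² + 4 z`. -/
def focalDisc (α β z : ℂ) : ℂ := (α - β) ^ 2 + 4 * z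

/-- The focus `(α + β) / 2 + √Δ / 2`. -/
def focusPlus (α β z : ℂ) : ℂ :=
  (α + β) / 2 + focalDisc α β z ^ (1 / 2 : ℂ) / 2

/-- The focus `(α + β) / 2 - √Δ / 2`. -/
def focusMinus (α β z : ℂ) : ℂ :=
  (α + β) / 2 - focalDisc α β z ^ (1 / 2 : ℂ) / 2

/-- The length of the major axis. -/
def majorAxis (α β z : ℂ) (h : ℝ) : ℝ :=
  √(‖α - β‖ ^ 2 / 2 + h + ‖focalDisc α β z‖ / 2)

/-- The closed elliptical disc attached to a pair `(z, h)` of joint eigenvalues. -/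
def blockDisc (α β z : ℂ) (h : ℝ) : Set ℂ :=
  ellipticalDisc (focusPlus α β z) (focusMinus α β z) (majorAxis α β z h)

/-- The minor axis of the ellipse bounding `blockDisc α β z h` has the expected length. -/
theorem minorAxisLength_blockDisc (α β z : ℂ) (h : ℝ) (hh : 0 ≤ h) :
    minorAxisLength (focusPlus α β z) (focusMinus α β z) (majorAxis α β z h) =
      √(‖α - β‖ ^ 2 / 2 + h - ‖focalDisc α β z‖ / 2) := by
  have h1 : (focalDisc α β z ^ (1 / 2 : ℂ)) ^ 2 = focalDisc α β z := by
    simp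
  have h2 : dist (focusPlus α β z) (focusMinus α β z) ^ 2 = ‖focalDisc α β z‖ := by
    rw [dist_eq_norm, ← norm_pow]
    congr 1
    rw [← h1, h1]
    unfold focusPlus focusMinus
    linear_combination h1
  unfold minorAxisLength
  rw [h2, majorAxis, Real.sq_sqrt (by positivity)]
  congr 1
  ring

end

/-!
Write `Z = DC` and `H = CᴴC + DDᴴ`. Squaring the inequality that defines an elliptical disc turns
`w ∈ blockDisc α β z h` into `2 |(α - w)(β - w) - z| ≤ h - 2 Re ((α - w) conj (β - w))`
(`mem_blockDisc_iff`). In this form the data `(z, h)` enter affinely, and comparing support functions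
shows that an inclusion of discs means `2 |z₁ - z₂| ≤ h₂ - h₁` (`norm_sub_le_of_blockDisc_subset`).

*The numerical range lies in the disc.* Let `P A P = c P` with `P` of rank `k + 1`, indices starting at
`0`. The range of `P` contains a nonzero vector `(u, v)` with `v` in the span of the joint eigenvectors of
index at least `k`. The form of `A - c` vanishes at `(u, v)`, and the nonnegativity of
`|φ C v + φ̄ Dᴴ v + 2 Re (φ (α - c)) u|²` for a suitable `φ` of modulus one yields the inequality
above for the averages of the `z j` and the `h j` with weights `|v j|²` (`norm_dotProduct_sub_le`).
Since `2 |z j - z k| ≤ h k - h j` for `k ≤ j`, it holds for `(z k, h k)` too.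

*The disc lies in the numerical range.* By nestedness, a point `c` of the disc of index `k` lies in all the
discs of index at most `k`. If `c = α`, any coordinate subspace of dimension `k + 1` of the first summand
will do; it exists since `n - r ≤ r`. Otherwise, after restricting the second summand to the first
`k + 1` joint eigenvectors and dividing `A - c` by `α - c`, the graph of `X` is an isotropic subspace as
soon as `Xᴴ X + Xᴴ C + D X + b = 0`. Completing the square with `S = (C + Dᴴ) / 2` leaves an
equation whose coefficients `SᴴS`, `TᴴT` and `SᴴT - TᴴS`, with `T = (C - Dᴴ) / 2`, are linear
combinations of `H`, `Z` and `Zᴴ`, hence diagonal. So the equation decouples into scalar ones, which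
are solvable precisely because `c` lies in each disc (`exists_graph_of_diagonal`).
-/

/-! ### Elliptical discs -/

/-- The elliptical disc without square roots: writing `f₁`, `f₂` for the foci and `L` for the major
axis, `|w - f₁| + |w - f₂| ≤ L` is squared, and `(w - f₁) (w - f₂) = (α - w) (β - w) - z`. -/
theorem mem_blockDisc_iff (α β z w : ℂ) {h : ℝ} (hh : 0 ≤ h) :
    w ∈ blockDisc α β z h ↔
      2 * ‖(α - w) * (β - w) - z‖ ≤ h - 2 * ((α - w) * star (β - w)).re := by
  have hs : (focalDisc α β z ^ (1 / 2 : ℂ)) ^ 2 = focalDisc α β z := by simp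
  simp only [blockDisc, ellipticalDisc, Set.mem_ofPred_eq, majorAxis, focusPlus, focusMinus]
  generalize focalDisc α β z ^ (1 / 2 : ℂ) = s at hs
  have hprod : ‖w - ((α + β) / 2 + s / 2)‖ * ‖w - ((α + β) / 2 - s / 2)‖ =
      ‖(α - w) * (β - w) - z‖ := by
    rw [← norm_mul]
    congr 1
    unfold focalDisc at hs
    linear_combination (-1 / 4 : ℂ) * hs
  have hsq : ‖w - ((α + β) / 2 + s / 2)‖ ^ 2 + ‖w - ((α + β) / 2 - s / 2)‖ ^ 2 =
      2 * ‖w - (α + β) / 2‖ ^ 2 + ‖focalDisc α β z‖ / 2 := by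
    rw [← hs, norm_pow]
    simp only [Complex.sq_norm, Complex.normSq_apply]
    simp
    ring
  have hmid : 2 * ‖w - (α + β) / 2‖ ^ 2 - ‖α - β‖ ^ 2 / 2 = 2 * ((α - w) * star (β - w)).re := by
    simp only [Complex.sq_norm, Complex.normSq_apply]
    simp
    ring
  have h0 : 0 ≤ ‖α - β‖ ^ 2 / 2 + h + ‖focalDisc α β z‖ / 2 := by positivity
  rw [dist_eq_norm, dist_eq_norm, Real.le_sqrt (by positivity) h0, ← hprod]
  constructor <;> intro H <;> nlinarith

theorem exists_sq_mul_eq_norm (a : ℂ) : ∃ φ : ℂ, ‖φ‖ = 1 ∧ φ ^ 2 * a = (‖a‖ : ℂ) := by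
  refine ⟨Complex.exp (((-a.arg / 2 : ℝ) : ℂ) * Complex.I), Complex.norm_exp_ofReal_mul_I _, ?_⟩
  nth_rw 2 [← Complex.norm_mul_exp_arg_mul_I a]
  rw [← Complex.exp_nat_mul, mul_left_comm, ← Complex.exp_add]
  have : ((2 : ℕ) : ℂ) * (((-a.arg / 2 : ℝ) : ℂ) * Complex.I) + (a.arg : ℂ) * Complex.I = 0 := by
    push_cast; ring
  rw [this, Complex.exp_zero, mul_one]

/-- Inclusion of the centred elliptical discs `2 |ω² - ζ| ≤ η - 2 |ω|²` in terms of their data. The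
squared support function of such a disc in the direction `star φ`, `|φ| = 1`, is
`(η + 2 Re (φ² ζ)) / 4`, so that the inclusion gives `2 Re (φ² (ζ₁ - ζ₂)) ≤ η₂ - η₁` for all `φ`. -/
theorem norm_sub_le_of_disc_subset {ζ₁ ζ₂ : ℂ} {η₁ η₂ : ℝ} (h₁ : 2 * ‖ζ₁‖ ≤ η₁)
    (H : ∀ ω : ℂ, 2 * ‖ω ^ 2 - ζ₁‖ ≤ η₁ - 2 * ‖ω‖ ^ 2 → 2 * ‖ω ^ 2 - ζ₂‖ ≤ η₂ - 2 * ‖ω‖ ^ 2) :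
    2 * ‖ζ₁ - ζ₂‖ ≤ η₂ - η₁ := by
  obtain ⟨φ, hφ, hφa⟩ := exists_sq_mul_eq_norm (ζ₁ - ζ₂)
  set ξ := φ ^ 2 * ζ₁ with hξ
  have hξn : 2 * ‖ξ‖ ≤ η₁ := by simpa [hξ, hφ] using h₁
  have hre := Complex.abs_re_le_norm ξ
  have hnn : ‖ξ‖ ^ 2 = ξ.re ^ 2 + ξ.im ^ 2 := by
    rw [Complex.sq_norm, Complex.normSq_apply]; ring
  have h0 : 0 ≤ η₁ + 2 * ξ.re := by linarith [(abs_le.mp hre).1]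
  have hprod : 4 * ξ.im ^ 2 ≤ (η₁ - 2 * ξ.re) * (η₁ + 2 * ξ.re) := by
    nlinarith [norm_nonneg ξ]
  obtain ⟨x, y, hx, hxy, hy⟩ : ∃ x y : ℝ, 4 * x ^ 2 = η₁ + 2 * ξ.re ∧ 2 * x * y = ξ.im ∧
      4 * y ^ 2 ≤ η₁ - 2 * ξ.re := by
    have hx : 4 * (√(η₁ + 2 * ξ.re) / 2) ^ 2 = η₁ + 2 * ξ.re := by
      rw [div_pow, Real.sq_sqrt h0]; ring
    rcases h0.eq_or_lt with h0 | h0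
    · refine ⟨0, 0, by simpa using h0, ?_, ?_⟩
      · rw [← h0] at hprod
        have : ξ.im ^ 2 ≤ 0 := by linarith
        simpa using (pow_eq_zero_iff two_ne_zero).mp (le_antisymm this (sq_nonneg _)) |>.symm
      · linarith [(abs_le.mp hre).2]
    · have hpos : 0 < √(η₁ + 2 * ξ.re) := Real.sqrt_pos.mpr h0
      set x := √(η₁ + 2 * ξ.re) / 2
      have hxpos : 0 < x := by positivity
      refine ⟨x, ξ.im / (2 * x), hx, by field_simp, ?_⟩
      rw [div_pow, mul_pow, ← mul_div_assoc, div_le_iff₀ (by positivity)]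
      calc 4 * ξ.im ^ 2 ≤ _ := hprod
        _ = _ := by rw [← hx]; ring
  -- the point of the first disc at which the linear form `Re (φ ω)` is largest
  have hφφ : φ * star φ = 1 := by
    rw [Complex.star_def, Complex.mul_conj, Complex.normSq_eq_norm_sq, hφ]; norm_num
  set ω : ℂ := star φ * ⟨x, y⟩ with hω
  have hφω : φ * ω = ⟨x, y⟩ := by rw [hω, ← mul_assoc, hφφ, one_mul]
  have hnω : ‖ω‖ ^ 2 = x ^ 2 + y ^ 2 := by
    rw [hω, norm_mul, norm_star, hφ, one_mul, Complex.sq_norm, Complex.normSq_apply]; ring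
  have hrot (ζ : ℂ) : ‖ω ^ 2 - ζ‖ = ‖(⟨x, y⟩ : ℂ) ^ 2 - φ ^ 2 * ζ‖ := by
    rw [← hφω, mul_pow φ ω, ← mul_sub, norm_mul, norm_pow, hφ, one_pow, one_mul]
  have hsq : (⟨x, y⟩ : ℂ) ^ 2 - ξ = ((η₁ / 2 - x ^ 2 - y ^ 2 : ℝ) : ℂ) := by
    apply Complex.ext
    · simp [pow_two]; linarith
    · simp [pow_two]; linarith
  have h2 := H ω (by
    rw [hrot, ← hξ, hsq, hnω, Complex.norm_real, Real.norm_of_nonneg (by linarith)]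
    linarith)
  rw [hrot, hnω] at h2
  have h3 := Complex.re_le_norm ((⟨x, y⟩ : ℂ) ^ 2 - φ ^ 2 * ζ₂)
  have h4 : φ ^ 2 * ζ₂ = ξ - (‖ζ₁ - ζ₂‖ : ℂ) := by rw [← hφa, hξ]; ring
  rw [h4] at h2 h3
  simp [pow_two] at h3
  simp only [pow_two] at h2 h3 hx
  linarith

theorem norm_sub_le_of_blockDisc_subset {α β z₁ z₂ : ℂ} {h₁ h₂ : ℝ} (hz₁ : 2 * ‖z₁‖ ≤ h₁)
    (hh₂ : 0 ≤ h₂) (H : blockDisc α β z₁ h₁ ⊆ blockDisc α β z₂ h₂) :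
    2 * ‖z₁ - z₂‖ ≤ h₂ - h₁ := by
  have hh₁ : 0 ≤ h₁ := le_trans (by positivity) hz₁
  set γ := (α - β) / 2 with hγ
  have key (z : ℂ) {h : ℝ} (hh : 0 ≤ h) (ω : ℂ) : (α + β) / 2 + ω ∈ blockDisc α β z h ↔
      2 * ‖ω ^ 2 - (z + γ ^ 2)‖ ≤ (h + 2 * ‖γ‖ ^ 2) - 2 * ‖ω‖ ^ 2 := by
    rw [mem_blockDisc_iff _ _ _ _ hh]
    have e1 : (α - ((α + β) / 2 + ω)) * (β - ((α + β) / 2 + ω)) - z = ω ^ 2 - (z + γ ^ 2) := by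
      rw [hγ]; ring
    have e2 : ((α - ((α + β) / 2 + ω)) * star (β - ((α + β) / 2 + ω))).re =
        ‖ω‖ ^ 2 - ‖γ‖ ^ 2 := by
      rw [hγ]
      simp only [Complex.sq_norm, Complex.normSq_apply]
      simp
      ring
    rw [e1, e2]
    constructor <;> intro <;> linarith
  have := norm_sub_le_of_disc_subset (ζ₁ := z₁ + γ ^ 2) (ζ₂ := z₂ + γ ^ 2)
    (η₁ := h₁ + 2 * ‖γ‖ ^ 2) (η₂ := h₂ + 2 * ‖γ‖ ^ 2)
    (by
      have := norm_add_le z₁ (γ ^ 2)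
      rw [norm_pow] at this
      linarith)
    (fun ω hω => (key z₂ hh₂ ω).1 (H ((key z₁ hh₁ ω).2 hω)))
  rw [add_sub_add_right_eq_sub] at this
  linarith

/-! ### Vectors with a prescribed value of the form -/

open Matrix ComplexOrder in
/-- If the form of `[α, C; D, β]` vanishes at `(u, v)`, with `c = C v`, `d = Dᴴ v` and `p = |v|²`, then
`p` times the inequality of `mem_blockDisc_iff` holds at `0` for the data `star d ⬝ᵥ c / p` and
`(|c|² + |d|²) / p`. -/
theorem norm_dotProduct_sub_le {ι : Type*} [Fintype ι] {u c d : ι → ℂ} {α β : ℂ} {p : ℝ}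
    (H : α * (star u ⬝ᵥ u) + star u ⬝ᵥ c + star d ⬝ᵥ u + β * p = 0) :
    2 * ‖p * (α * β) - star d ⬝ᵥ c‖ ≤
      (star c ⬝ᵥ c + star d ⬝ᵥ d).re - 2 * p * (α * star β).re := by
  obtain ⟨φ, hφ, hφa⟩ := exists_sq_mul_eq_norm (p * (α * β) - star d ⬝ᵥ c)
  have hφφ : φ * star φ = 1 := by
    rw [Complex.star_def, Complex.mul_conj, Complex.normSq_eq_norm_sq, hφ]; norm_num
  -- with this `τ`, the hypothesis `H` eliminates `u` from `|φ c + φ̄ d + τ u|²`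
  set τ : ℝ := 2 * (φ * α).re with hτ
  have h0 : 0 ≤ (star (φ • c + star φ • d + (τ : ℂ) • u) ⬝ᵥ (φ • c + star φ • d + (τ : ℂ) • u)).re :=
    (Complex.nonneg_iff.mp (dotProduct_star_self_nonneg _)).1
  have e : star (φ • c + star φ • d + (τ : ℂ) • u) ⬝ᵥ (φ • c + star φ • d + (τ : ℂ) • u) =
      (φ * star φ) * (star c ⬝ᵥ c + star d ⬝ᵥ d) + φ ^ 2 * (star d ⬝ᵥ c) +
        star φ ^ 2 * (star c ⬝ᵥ d) + τ * (φ * (star u ⬝ᵥ c + star d ⬝ᵥ u)) +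
        τ * (star φ * (star c ⬝ᵥ u + star u ⬝ᵥ d)) + τ ^ 2 * (star u ⬝ᵥ u) := by
    have hτs : star (τ : ℂ) = τ := Complex.conj_ofReal τ
    have hss : star (star φ) = φ := star_star φ
    simp only [star_add, star_smul, hss, add_dotProduct, dotProduct_add, smul_dotProduct,
      dotProduct_smul, smul_eq_mul, hτs]
    ring
  have hcd : star c ⬝ᵥ d = star (star d ⬝ᵥ c) := star_dotProduct _ _
  have hcu : star c ⬝ᵥ u = star (star u ⬝ᵥ c) := star_dotProduct _ _
  have hud : star u ⬝ᵥ d = star (star d ⬝ᵥ u) := star_dotProduct _ _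
  have huu : star u ⬝ᵥ u = ((star u ⬝ᵥ u).re : ℂ) :=
    Complex.ext rfl (Complex.nonneg_iff.mp (dotProduct_star_self_nonneg _)).2.symm
  rw [e, hφφ, hcd, hcu, hud, huu] at h0
  rw [huu] at H
  have H' : star u ⬝ᵥ c + star d ⬝ᵥ u = -(α * ((star u ⬝ᵥ u).re : ℂ) + β * p) := by
    linear_combination H
  rw [← star_add, H'] at h0
  generalize (star u ⬝ᵥ u).re = s at *
  generalize star d ⬝ᵥ c = w at *
  have hw : φ ^ 2 * w = φ ^ 2 * (p * (α * β)) - ‖p * (α * β) - w‖ := by rw [← hφa]; ring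
  have hw' : star φ ^ 2 * star w = star (φ ^ 2 * w) := by simp
  rw [hw', hw] at h0
  have hn : φ.re * φ.re + φ.im * φ.im = 1 := by
    have := congrArg Complex.re hφφ
    simpa using this
  generalize ‖p * (α * β) - w‖ = N at *
  generalize star c ⬝ᵥ c + star d ⬝ᵥ d = q at *
  simp [pow_two] at h0 hτ ⊢
  have : α.re * β.re + α.im * β.im =
    (φ.re * φ.re + φ.im * φ.im) * (α.re * β.re + α.im * β.im) := by rw [hn, one_mul]
  rw [this]
  rw [hτ] at h0
  linarith

open Matrix in
theorem star_mulVec_dotProduct_mulVec {ι κ l : Type*} [Fintype ι] [Fintype κ] [Fintype l]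
    (A : Matrix ι κ ℂ) (B : Matrix ι l ℂ) (x : κ → ℂ) (y : l → ℂ) :
    star (A *ᵥ x) ⬝ᵥ (B *ᵥ y) = star x ⬝ᵥ ((Aᴴ * B) *ᵥ y) := by
  rw [star_mulVec, ← dotProduct_mulVec, mulVec_mulVec]

open Matrix in
theorem star_dotProduct_mulVec_of_diagonalized {μ κ : Type*} [Fintype μ] [Fintype κ]
    [DecidableEq κ] {M : Matrix μ μ ℂ} {W : Matrix μ κ ℂ} {d : κ → ℂ}
    (hM : Wᴴ * M * W = diagonal d) (ν : κ → ℂ) :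
    star (W *ᵥ ν) ⬝ᵥ (M *ᵥ (W *ᵥ ν)) = ∑ j, ((‖ν j‖ ^ 2 : ℝ) : ℂ) * d j := by
  rw [mulVec_mulVec, star_mulVec_dotProduct_mulVec, ← Matrix.mul_assoc, hM]
  refine Finset.sum_congr rfl fun j _ => ?_
  rw [mulVec_diagonal, Pi.star_apply, Complex.star_def, ← Complex.normSq_eq_norm_sq,
    Complex.normSq_eq_conj_mul_self]
  ring

open Matrix ComplexOrder in
theorem two_mul_norm_le_of_diagonalized {ρ μ κ : Type*} [Fintype ρ] [Fintype μ] [Fintype κ]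
    [DecidableEq κ] {C : Matrix ρ μ ℂ} {D : Matrix μ ρ ℂ} {W : Matrix μ κ ℂ} {z : κ → ℂ} {h : κ → ℝ}
    (hz : Wᴴ * (D * C) * W = diagonal z)
    (hh : Wᴴ * (Cᴴ * C + D * Dᴴ) * W = diagonal fun j => (h j : ℂ)) (j : κ) :
    2 * ‖z j‖ ≤ h j := by
  have H := norm_dotProduct_sub_le (u := (0 : ρ → ℂ)) (c := C *ᵥ (W *ᵥ Pi.single j 1))
    (d := Dᴴ *ᵥ (W *ᵥ Pi.single j 1)) (α := 0) (β := 0) (p := 0) (by simp)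
  rw [star_mulVec_dotProduct_mulVec Dᴴ C, star_mulVec_dotProduct_mulVec C C,
    star_mulVec_dotProduct_mulVec Dᴴ Dᴴ,
    conjTranspose_conjTranspose, ← dotProduct_add, ← add_mulVec,
    star_dotProduct_mulVec_of_diagonalized hz, star_dotProduct_mulVec_of_diagonalized hh] at H
  simpa [Pi.single_apply, apply_ite, ite_pow] using H

open Matrix ComplexOrder in
/-- A point of the rank-`(k + 1)` numerical range lies in the disc of index `k`. A range of dimension
`k + 1` contains a nonzero `x = (u, v)` with `v` in the span of the `U eⱼ`, `k ≤ j`;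
`norm_dotProduct_sub_le` applied to `x` gives the inequality for an average of the pairs `(z j, h j)`,
`k ≤ j`, and the hypothesis `hle` lets `(z k, h k)` replace the average. -/
theorem norm_sub_le_of_mem_rankNumericalRange {ρ : Type*} [Fintype ρ] [DecidableEq ρ] {m : ℕ}
    {α β : ℂ} {C : Matrix ρ (Fin m) ℂ} {D : Matrix (Fin m) ρ ℂ} {U : Matrix (Fin m) (Fin m) ℂ}
    (hU : U ∈ unitaryGroup (Fin m) ℂ) {z : Fin m → ℂ} {h : Fin m → ℝ}
    (hz : Uᴴ * (D * C) * U = diagonal z)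
    (hh : Uᴴ * (Cᴴ * C + D * Dᴴ) * U = diagonal fun j => (h j : ℂ)) (k : Fin m)
    (hk : 2 * ‖z k‖ ≤ h k) (hle : ∀ j, k ≤ j → 2 * ‖z j - z k‖ ≤ h k - h j) {c : ℂ}
    (hc : c ∈ rankNumericalRange (k.val + 1) (fromBlocks (α • 1) C D (β • 1))) :
    2 * ‖(α - c) * (β - c) - z k‖ ≤ h k - 2 * ((α - c) * star (β - c)).re := by
  obtain ⟨P, hP, hPP, hrank, hPAP⟩ := hc
  -- `range P` meets the vectors whose second component lies in the span of `U eⱼ`, `k ≤ j`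
  let L : LinearMap.range P.mulVecLin →ₗ[ℂ] (Fin k.val → ℂ) :=
    LinearMap.pi (fun j => LinearMap.proj (Fin.castLE k.isLt.le j)) ∘ₗ Uᴴ.mulVecLin ∘ₗ
      LinearMap.funLeft ℂ ℂ Sum.inr ∘ₗ (LinearMap.range P.mulVecLin).subtype
  have hker : LinearMap.ker L ≠ ⊥ := by
    apply LinearMap.ker_ne_bot_of_finrank_lt
    rw [Module.finrank_fin_fun]
    change k.val < P.rank
    omega
  obtain ⟨⟨x, w, hw⟩, hx, hx0⟩ := Submodule.exists_mem_ne_zero_of_ne_bot hker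
  have hx0 : x ≠ 0 := fun h => hx0 (Subtype.ext h)
  have hPx : P *ᵥ x = x := by
    rw [← hw, mulVecLin_apply, mulVec_mulVec, hPP]
  obtain ⟨u, v, rfl⟩ : ∃ u v, x = Sum.elim u v := ⟨_, _, (Sum.elim_comp_inl_inr x).symm⟩
  set ν := Uᴴ *ᵥ v with hν
  have hν0 (j : Fin m) (hj : j < k) : ν j = 0 := congrFun hx ⟨j, hj⟩
  have hvν : v = U *ᵥ ν := by
    rw [hν, mulVec_mulVec, ← star_eq_conjTranspose, mem_unitaryGroup_iff.1 hU, one_mulVec]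
  have hiso : α * (star u ⬝ᵥ u) + star u ⬝ᵥ (C *ᵥ v) + star (Dᴴ *ᵥ v) ⬝ᵥ u + β * (star v ⬝ᵥ v) =
      c * (star u ⬝ᵥ u + star v ⬝ᵥ v) := by
    have h1 : star (Sum.elim u v) ⬝ᵥ (fromBlocks (α • 1) C D (β • 1) *ᵥ Sum.elim u v) =
        c * (star (Sum.elim u v) ⬝ᵥ Sum.elim u v) := by
      conv_lhs => rw [← hPx]
      rw [mulVec_mulVec, star_mulVec_dotProduct_mulVec, hP.eq, ← Matrix.mul_assoc, hPAP,
        smul_mulVec, hPx, dotProduct_smul, smul_eq_mul]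
    have h2 : star (Sum.elim u v) = Sum.elim (star u) (star v) := by
      ext i; cases i <;> rfl
    rw [h2, fromBlocks_mulVec, Sum.elim_comp_inl, Sum.elim_comp_inr, sumElim_dotProduct_sumElim,
      sumElim_dotProduct_sumElim, dotProduct_add, dotProduct_add, smul_mulVec, smul_mulVec,
      one_mulVec, one_mulVec, dotProduct_smul, dotProduct_smul, smul_eq_mul, smul_eq_mul] at h1
    rw [star_mulVec, conjTranspose_conjTranspose, ← dotProduct_mulVec, ← h1]
    ring
  have hvv : star v ⬝ᵥ v = ((∑ j, ‖ν j‖ ^ 2 : ℝ) : ℂ) := by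
    have := star_dotProduct_mulVec_of_diagonalized (M := 1) (W := U) (d := fun _ => 1)
      (by rw [Matrix.mul_one, ← star_eq_conjTranspose, mem_unitaryGroup_iff'.1 hU, diagonal_one]) ν
    rw [one_mulVec, ← hvν] at this
    rw [this]
    simp
  set p : ℝ := ∑ j, ‖ν j‖ ^ 2 with hp
  have hpnn : 0 ≤ p := Finset.sum_nonneg fun j _ => sq_nonneg ‖ν j‖
  rcases hpnn.eq_or_lt with hp0 | hp0
  · rw [← hp0, Complex.ofReal_zero] at hvv
    -- if `v = 0`, isotropy forces `c = α`
    have hv : v = 0 := dotProduct_star_self_eq_zero.1 hvv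
    subst hv
    have hu : star u ⬝ᵥ u ≠ 0 := fun hu => hx0 (by
      rw [dotProduct_star_self_eq_zero.1 hu]
      exact Sum.elim_zero_zero)
    have hαc : α - c = 0 := by
      simp at hiso
      rw [sub_eq_zero]
      exact hiso.resolve_right (by simpa using hu)
    simpa [hαc] using hk
  have H := norm_dotProduct_sub_le (u := u) (c := C *ᵥ v) (d := Dᴴ *ᵥ v) (α := α - c)
    (β := β - c) (p := p) (by rw [← hvv]; linear_combination hiso)
  rw [star_mulVec_dotProduct_mulVec Dᴴ C, star_mulVec_dotProduct_mulVec C C,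
    star_mulVec_dotProduct_mulVec Dᴴ Dᴴ,
    conjTranspose_conjTranspose, ← dotProduct_add, ← add_mulVec, hvν,
    star_dotProduct_mulVec_of_diagonalized hz, star_dotProduct_mulVec_of_diagonalized hh] at H
  simp only [← Complex.ofReal_mul, ← Complex.ofReal_sum, Complex.ofReal_re] at H
  have hdev : 2 * ‖∑ j, ((‖ν j‖ ^ 2 : ℝ) : ℂ) * (z j - z k)‖ ≤ ∑ j, ‖ν j‖ ^ 2 * (h k - h j) := by
    refine (mul_le_mul_of_nonneg_left (norm_sum_le _ _) zero_le_two).trans ?_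
    rw [Finset.mul_sum]
    refine Finset.sum_le_sum fun j _ => ?_
    rw [norm_mul, Complex.norm_real, Real.norm_of_nonneg (sq_nonneg _), mul_left_comm]
    rcases lt_or_ge j k with hj | hj
    · simp [hν0 j hj]
    · exact mul_le_mul_of_nonneg_left (hle j hj) (sq_nonneg _)
  have e1 : (p : ℂ) * ((α - c) * (β - c) - z k) =
      (p * ((α - c) * (β - c)) - ∑ j, ((‖ν j‖ ^ 2 : ℝ) : ℂ) * z j) +
        ∑ j, ((‖ν j‖ ^ 2 : ℝ) : ℂ) * (z j - z k) := by
    simp only [mul_sub, Finset.sum_sub_distrib, ← Finset.sum_mul]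
    rw [hp, Complex.ofReal_sum]
    ring
  have e2 : ∑ j, ‖ν j‖ ^ 2 * (h k - h j) = p * h k - ∑ j, ‖ν j‖ ^ 2 * h j := by
    simp only [mul_sub, Finset.sum_sub_distrib, ← Finset.sum_mul, hp]
  have e3 := norm_add_le (p * ((α - c) * (β - c)) - ∑ j, ((‖ν j‖ ^ 2 : ℝ) : ℂ) * z j)
    (∑ j, ((‖ν j‖ ^ 2 : ℝ) : ℂ) * (z j - z k))
  rw [← e1, norm_mul, Complex.norm_real, Real.norm_of_nonneg hp0.le] at e3
  refine le_of_mul_le_mul_left ?_ hp0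
  linarith


/-! ### Subspaces with a scalar compression -/

/-- A matrix `G` of full column rank with `Gᴴ A G = c Gᴴ G` puts `c` in the numerical range of `A` of
rank `card κ`, by the orthogonal projection `G (Gᴴ G)⁻¹ Gᴴ` onto the range of `G`. -/
theorem mem_rankNumericalRange_of_compression {ι κ : Type*} [Fintype ι] [DecidableEq ι] [Fintype κ]
    [DecidableEq κ] {A : Matrix ι ι ℂ} {c : ℂ} (G : Matrix ι κ ℂ) (hG : IsUnit (Gᴴ * G))
    (H : Gᴴ * A * G = c • (Gᴴ * G)) : c ∈ rankNumericalRange (Fintype.card κ) A := by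
  have hdet := (Matrix.isUnit_iff_isUnit_det _).1 hG
  have hGP : Gᴴ * (G * (Gᴴ * G)⁻¹ * Gᴴ) = Gᴴ := by
    rw [Matrix.mul_assoc G, ← Matrix.mul_assoc, ← Matrix.mul_assoc, Matrix.mul_nonsing_inv _ hdet,
      Matrix.one_mul]
  refine ⟨G * (Gᴴ * G)⁻¹ * Gᴴ, ?_, ?_, ?_, ?_⟩
  · simp [Matrix.IsHermitian, Matrix.conjTranspose_nonsing_inv, Matrix.mul_assoc]
  · conv_lhs => rw [Matrix.mul_assoc _ Gᴴ, hGP]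
  · apply le_antisymm
    · exact (Matrix.rank_mul_le_right _ _).trans (Matrix.rank_le_card_height _)
    · calc Fintype.card κ = (Gᴴ * (G * (Gᴴ * G)⁻¹ * Gᴴ) * G).rank := by
            rw [hGP, Matrix.rank_of_isUnit _ hG]
        _ ≤ (Gᴴ * (G * (Gᴴ * G)⁻¹ * Gᴴ)).rank := Matrix.rank_mul_le_left _ _
        _ ≤ _ := Matrix.rank_mul_le_right _ _
  · calc G * (Gᴴ * G)⁻¹ * Gᴴ * A * (G * (Gᴴ * G)⁻¹ * Gᴴ)
        = G * (Gᴴ * G)⁻¹ * (Gᴴ * A * G) * (Gᴴ * G)⁻¹ * Gᴴ := by simp only [Matrix.mul_assoc]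
      _ = c • (G * ((Gᴴ * G)⁻¹ * (Gᴴ * G)) * (Gᴴ * G)⁻¹ * Gᴴ) := by
        rw [H]; simp [Matrix.mul_assoc]
      _ = _ := by rw [Matrix.nonsing_inv_mul _ hdet, Matrix.mul_one]

/-- A matrix with orthogonal columns of lengths `|t j|` is an isometry times `diagonal t`. The columns
with `t j = 0` are replaced by unit vectors that complete the others, for which there is room in `ρ`. -/
theorem exists_isometry_mul_diagonal {ρ κ : Type*} [Fintype ρ] [DecidableEq ρ] [Fintype κ]
    [DecidableEq κ] (e : κ ↪ ρ) {T : Matrix ρ κ ℂ} {t : κ → ℝ}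
    (hT : Tᴴ * T = Matrix.diagonal fun j => ((t j ^ 2 : ℝ) : ℂ)) :
    ∃ F : Matrix ρ κ ℂ, Fᴴ * F = 1 ∧ T = F * Matrix.diagonal fun j => (t j : ℂ) := by
  let τ (j : κ) : EuclideanSpace ℂ ρ := WithLp.toLp 2 (T.col j)
  have hτ (i j : κ) : inner ℂ (τ i) (τ j) = if i = j then ((t i ^ 2 : ℝ) : ℂ) else 0 := by
    have := congrFun (congrFun hT i) j
    rw [Matrix.diagonal_apply] at this
    rw [← this, EuclideanSpace.inner_eq_star_dotProduct, dotProduct_comm]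
    rfl
  let v : ρ → EuclideanSpace ℂ ρ := Function.extend e (fun j => ((t j : ℂ)⁻¹) • τ j) 0
  have hv (j : κ) : v (e j) = ((t j : ℂ)⁻¹) • τ j := e.injective.extend_apply _ _ _
  have horth : Orthonormal ℂ ((e '' {j | t j ≠ 0}).domRestrict v) := by
    rw [orthonormal_iff_ite]
    rintro ⟨x, hx⟩ ⟨y, hy⟩
    obtain ⟨i, hi, rfl⟩ := id hx
    obtain ⟨j, hj, rfl⟩ := id hy
    rw [Set.domRestrict_apply, Set.domRestrict_apply, hv, hv, inner_smul_left, inner_smul_right, hτ]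
    simp only [Subtype.mk.injEq, e.injective.eq_iff]
    have hi : (t i : ℂ) ≠ 0 := by simpa using hi
    split_ifs with hij
    · subst hij
      simp
      field_simp
    · simp
  obtain ⟨b, hb⟩ := horth.exists_orthonormalBasis_extension_of_card_eq (by simp)
  refine ⟨Matrix.of fun i j => b (e j) i, ?_, ?_⟩
  · ext i j
    have := orthonormal_iff_ite.1 b.orthonormal (e i) (e j)
    rw [EuclideanSpace.inner_eq_star_dotProduct, dotProduct_comm] at this
    simp only [e.injective.eq_iff] at this
    rw [Matrix.one_apply, ← this]
    rfl
  · ext i j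
    rw [Matrix.mul_diagonal, Matrix.of_apply]
    by_cases hj : t j = 0
    · have h0 : τ j = 0 := by
        rw [← inner_self_eq_zero (𝕜 := ℂ), hτ]; simp [hj]
      have : τ j i = 0 := by rw [h0]; rfl
      rw [hj]
      simpa [τ] using this
    · rw [hb (e j) ⟨j, hj, rfl⟩, hv]
      have : (t j : ℂ) ≠ 0 := by simpa using hj
      simp [τ]
      field_simp

theorem exists_norm_sq_eq_and_im_eq {q t g : ℝ} (hq : 0 ≤ q) (hg : g ^ 2 ≤ 4 * t ^ 2 * q) :
    ∃ y : ℂ, ‖y‖ ^ 2 = q ∧ 2 * t * y.im = g := by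
  rcases eq_or_ne t 0 with rfl | ht
  · refine ⟨(√q : ℝ), by simp [Real.sq_sqrt hq], ?_⟩
    have : g ^ 2 = 0 := le_antisymm (by simpa using hg) (sq_nonneg g)
    rw [pow_eq_zero_iff two_ne_zero] at this
    simp [this]
  · have : (g / (2 * t)) ^ 2 ≤ q := by
      rw [div_pow, div_le_iff₀ (by positivity)]
      linarith
    refine ⟨⟨√(q - (g / (2 * t)) ^ 2), g / (2 * t)⟩, ?_, by field_simp⟩
    rw [Complex.sq_norm, Complex.normSq_apply, Real.mul_self_sqrt (by linarith)]
    ring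

/-- With `S = (C + Dᴴ) / 2`, `T = (C - Dᴴ) / 2` and `X = Y - S` the equation reads
`Yᴴ Y + (Yᴴ T - Tᴴ Y) = Sᴴ S + (Sᴴ T - Tᴴ S) - b`, where the right side and `Tᴴ T` are diagonal. If
`T = F diagonal t` with `F` an isometry, then `Y = F diagonal y` reduces it to one scalar equation for
each `y j`. -/
theorem exists_graph_of_diagonal {ρ κ : Type*} [Fintype ρ] [DecidableEq ρ] [Fintype κ]
    [DecidableEq κ] (e : κ ↪ ρ) {C : Matrix ρ κ ℂ} {D : Matrix κ ρ ℂ} {b : ℂ} {z : κ → ℂ}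
    {h : κ → ℝ} (hz : D * C = Matrix.diagonal z)
    (hh : Cᴴ * C + D * Dᴴ = Matrix.diagonal fun j => (h j : ℂ))
    (H : ∀ j, 2 * ‖b - z j‖ ≤ h j - 2 * b.re) :
    ∃ X : Matrix ρ κ ℂ, Xᴴ * X + Xᴴ * C + D * X + b • 1 = 0 := by
  have hz' : Cᴴ * Dᴴ = Matrix.diagonal (star z) := by
    rw [← Matrix.conjTranspose_mul, hz, Matrix.diagonal_conjTranspose]
  set S : Matrix ρ κ ℂ := (1 / 2 : ℂ) • (C + Dᴴ) with hS
  set T : Matrix ρ κ ℂ := (1 / 2 : ℂ) • (C - Dᴴ) with hT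
  have hSH : Sᴴ = (1 / 2 : ℂ) • (Cᴴ + D) := by simp [hS]
  have hTH : Tᴴ = (1 / 2 : ℂ) • (Cᴴ - D) := by simp [hT]
  have hC : C = S + T := by rw [hS, hT]; module
  have hD : D = Sᴴ - Tᴴ := by rw [hSH, hTH]; module
  have hSS : Sᴴ * S = Matrix.diagonal fun j => ((h j : ℂ) + z j + star (z j)) / 4 := by
    have : Sᴴ * S = (1 / 4 : ℂ) • ((Cᴴ * C + D * Dᴴ) + D * C + Cᴴ * Dᴴ) := by
      rw [hSH, hS]
      simp only [Matrix.smul_mul, Matrix.mul_smul, Matrix.mul_add, Matrix.add_mul]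
      module
    rw [this, hh, hz, hz', Matrix.diagonal_add, Matrix.diagonal_add, ← Matrix.diagonal_smul]
    congr 1; ext j; simp; ring
  have hTT : Tᴴ * T = Matrix.diagonal fun j => ((h j : ℂ) - z j - star (z j)) / 4 := by
    have : Tᴴ * T = (1 / 4 : ℂ) • ((Cᴴ * C + D * Dᴴ) - D * C - Cᴴ * Dᴴ) := by
      rw [hTH, hT]
      simp only [Matrix.smul_mul, Matrix.mul_smul, Matrix.mul_sub, Matrix.sub_mul]
      module
    rw [this, hh, hz, hz', Matrix.diagonal_sub, Matrix.diagonal_sub, ← Matrix.diagonal_smul]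
    congr 1; ext j; simp; ring
  have hST : Sᴴ * T - Tᴴ * S = Matrix.diagonal fun j => (z j - star (z j)) / 2 := by
    have : Sᴴ * T - Tᴴ * S = (1 / 2 : ℂ) • (D * C - Cᴴ * Dᴴ) := by
      rw [hTH, hT, hSH, hS]
      simp only [Matrix.smul_mul, Matrix.mul_smul, Matrix.mul_sub, Matrix.sub_mul, Matrix.mul_add,
        Matrix.add_mul]
      module
    rw [this, hz, hz', Matrix.diagonal_sub, ← Matrix.diagonal_smul]
    congr 1; ext j; simp; ring
  have hre (j : κ) : |b.re - (z j).re| ≤ ‖b - z j‖ := by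
    simpa using Complex.abs_re_le_norm (b - z j)
  have hnn (j : κ) : ‖b - z j‖ ^ 2 = (b.re - (z j).re) ^ 2 + (b.im - (z j).im) ^ 2 := by
    rw [Complex.sq_norm, Complex.normSq_apply]; simp; ring
  have ht (j : κ) : 0 ≤ (h j - 2 * (z j).re) / 4 := by
    linarith [H j, (abs_le.mp (hre j)).1, (abs_le.mp (hre j)).2]
  obtain ⟨t, ht2⟩ : ∃ t : κ → ℝ, ∀ j, t j ^ 2 = (h j - 2 * (z j).re) / 4 :=
    ⟨fun j => √((h j - 2 * (z j).re) / 4), fun j => Real.sq_sqrt (ht j)⟩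
  obtain ⟨F, hF, hTF⟩ := exists_isometry_mul_diagonal e (T := T) (t := t) (by
      rw [hTT]
      congr 1; ext j
      rw [ht2]
      apply Complex.ext <;> simp
      ring)
  -- the Hermitian part of the equation prescribes `|y j|`, the skew-Hermitian part `t j * Im (y j)`
  have hy (j : κ) := exists_norm_sq_eq_and_im_eq (q := (h j + 2 * (z j).re) / 4 - b.re)
    (t := t j) (g := b.im - (z j).im)
    (by linarith [H j, (abs_le.mp (hre j)).1, (abs_le.mp (hre j)).2])
    (by
      rw [ht2]
      nlinarith [H j, hnn j, norm_nonneg (b - z j)])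
  choose y hyq hyt using hy
  set Y : Matrix ρ κ ℂ := F * Matrix.diagonal y with hY
  have hYH : Yᴴ = Matrix.diagonal (star y) * Fᴴ := by
    rw [hY, Matrix.conjTranspose_mul, Matrix.diagonal_conjTranspose]
  have hTH' : Tᴴ = Matrix.diagonal (fun j => (t j : ℂ)) * Fᴴ := by
    rw [hTF, Matrix.conjTranspose_mul, Matrix.diagonal_conjTranspose]
    congr 2; ext j; simp
  have hFF (p q : κ → ℂ) : Matrix.diagonal p * Fᴴ * (F * Matrix.diagonal q) =
      Matrix.diagonal fun j => p j * q j := by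
    rw [Matrix.mul_assoc, ← Matrix.mul_assoc Fᴴ, hF, Matrix.one_mul, Matrix.diagonal_mul_diagonal]
  refine ⟨Y - S, ?_⟩
  have hexp : (Y - S)ᴴ * (Y - S) + (Y - S)ᴴ * C + D * (Y - S) + b • 1 =
      Yᴴ * Y + Yᴴ * T - Tᴴ * Y - Sᴴ * S - (Sᴴ * T - Tᴴ * S) + b • 1 := by
    rw [hC, hD]
    simp only [Matrix.conjTranspose_sub, Matrix.mul_sub, Matrix.sub_mul, Matrix.mul_add]
    abel
  rw [hexp, hSS, hST, hYH, hTH', hY, hTF, hFF, hFF, hFF, Matrix.smul_one_eq_diagonal]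
  simp only [Matrix.diagonal_add, Matrix.diagonal_sub]
  rw [← Matrix.diagonal_zero]
  congr 1; ext j
  have h1 := hyq j
  have h2 := hyt j
  rw [Complex.sq_norm, Complex.normSq_apply] at h1
  apply Complex.ext
  · simp; linarith
  · simp; linarith

open ComplexOrder in
/-- If `c` lies in the discs of all the pairs `(z j, h j)`, `j : κ`, and there is room for `κ` in the
first summand, then `A` compresses to `c` on a subspace of dimension `card κ`: for `c ≠ α` the graph
of a matrix `X` that solves `Xᴴ X + Xᴴ C' + D' X + b = 0`, where `C' = C W / (α - c)`,
`D' = Wᴴ D / (α - c)` and `b = (β - c) / (α - c)`. -/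
theorem mem_rankNumericalRange_fromBlocks {ρ μ κ : Type*} [Fintype ρ] [DecidableEq ρ] [Fintype μ]
    [DecidableEq μ] [Fintype κ] [DecidableEq κ] (e : κ ↪ ρ) {α β : ℂ} {C : Matrix ρ μ ℂ}
    {D : Matrix μ ρ ℂ} {W : Matrix μ κ ℂ} (hW : Wᴴ * W = 1) {z : κ → ℂ} {h : κ → ℝ}
    (hz : Wᴴ * (D * C) * W = Matrix.diagonal z)
    (hh : Wᴴ * (Cᴴ * C + D * Dᴴ) * W = Matrix.diagonal fun j => (h j : ℂ)) {c : ℂ}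
    (H : ∀ j, 2 * ‖(α - c) * (β - c) - z j‖ ≤ h j - 2 * ((α - c) * star (β - c)).re) :
    c ∈ rankNumericalRange (Fintype.card κ) (Matrix.fromBlocks (α • 1) C D (β • 1)) := by
  by_cases hα : α - c = 0
  · -- `c = α` is attained on a coordinate subspace of the first summand
    obtain rfl : α = c := sub_eq_zero.1 hα
    have hJ : ((1 : Matrix ρ ρ ℂ).submatrix id e)ᴴ * (1 : Matrix ρ ρ ℂ).submatrix id e = 1 := by
      rw [Matrix.conjTranspose_submatrix, Matrix.conjTranspose_one,
        ← Matrix.submatrix_mul _ _ e id e Function.bijective_id, Matrix.one_mul,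
        Matrix.submatrix_one _ e.injective]
    refine mem_rankNumericalRange_of_compression
      (Matrix.fromRows ((1 : Matrix ρ ρ ℂ).submatrix id e) (0 : Matrix μ κ ℂ)) ?_ ?_
    · rw [Matrix.conjTranspose_fromRows_eq_fromCols_conjTranspose, Matrix.fromCols_mul_fromRows, hJ]
      simp
    · rw [Matrix.mul_assoc, Matrix.fromBlocks_mul_fromRows,
        Matrix.conjTranspose_fromRows_eq_fromCols_conjTranspose, Matrix.fromCols_mul_fromRows,
        Matrix.fromCols_mul_fromRows]
      simp
  -- division by `α - c` reduces to a form with upper left block `1`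
  set a := α - c with ha
  have hsa : star a ≠ 0 := star_ne_zero.2 hα
  have hna : 0 < ‖a‖ ^ 2 := by positivity
  have haa : star a * a = (‖a‖ ^ 2 : ℝ) := by
    rw [Complex.star_def, ← Complex.normSq_eq_conj_mul_self, Complex.normSq_eq_norm_sq]
  obtain ⟨X, hX⟩ := exists_graph_of_diagonal e (C := a⁻¹ • (C * W)) (D := a⁻¹ • (Wᴴ * D))
    (b := a⁻¹ * (β - c)) (z := fun j => a⁻¹ ^ 2 * z j) (h := fun j => (‖a‖ ^ 2)⁻¹ * h j)
    (by
      have : a⁻¹ • (Wᴴ * D) * (a⁻¹ • (C * W)) = a⁻¹ ^ 2 • (Wᴴ * (D * C) * W) := by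
        rw [Matrix.smul_mul, Matrix.mul_smul, smul_smul, pow_two]
        simp only [Matrix.mul_assoc]
      rw [this, hz, ← Matrix.diagonal_smul]
      rfl)
    (by
      have : (a⁻¹ • (C * W))ᴴ * (a⁻¹ • (C * W)) + a⁻¹ • (Wᴴ * D) * (a⁻¹ • (Wᴴ * D))ᴴ =
          (star a * a)⁻¹ • (Wᴴ * (Cᴴ * C + D * Dᴴ) * W) := by
        simp only [Matrix.conjTranspose_smul, Matrix.conjTranspose_mul,
          Matrix.conjTranspose_conjTranspose, Matrix.smul_mul, Matrix.mul_smul, smul_smul,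
          Matrix.mul_add, Matrix.add_mul, smul_add, mul_inv, star_inv₀, Matrix.mul_assoc,
          mul_comm a⁻¹]
      rw [this, hh, ← Matrix.diagonal_smul, haa]
      congr 1; ext j; simp)
    (fun j => by
      have e1 : a⁻¹ * (β - c) - a⁻¹ ^ 2 * z j = a⁻¹ ^ 2 * (a * (β - c) - z j) := by
        field_simp
      have e2 : (a⁻¹ * (β - c)).re = (‖a‖ ^ 2)⁻¹ * (a * star (β - c)).re := by
        have : a⁻¹ * (β - c) = (((‖a‖ ^ 2)⁻¹ : ℝ) : ℂ) * star (a * star (β - c)) := by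
          rw [Complex.ofReal_inv, ← haa, star_mul, star_star]
          field_simp
        rw [this, Complex.re_ofReal_mul, Complex.star_def, Complex.conj_re]
      rw [e1, e2, norm_mul, norm_pow, norm_inv, inv_pow]
      have := mul_le_mul_of_nonneg_left (H j) (inv_nonneg.2 hna.le)
      linarith)
  have hGG : (Matrix.fromRows X W)ᴴ * Matrix.fromRows X W = Xᴴ * X + 1 := by
    rw [Matrix.conjTranspose_fromRows_eq_fromCols_conjTranspose, Matrix.fromCols_mul_fromRows, hW]
  refine mem_rankNumericalRange_of_compression (Matrix.fromRows X W) ?_ ?_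
  · rw [hGG]
    exact (Matrix.PosDef.posSemidef_add (Matrix.posSemidef_conjTranspose_mul_self X)
      Matrix.PosDef.one).isUnit
  · rw [hGG, Matrix.mul_assoc, Matrix.fromBlocks_mul_fromRows,
      Matrix.conjTranspose_fromRows_eq_fromCols_conjTranspose, Matrix.fromCols_mul_fromRows]
    have h1 := congrArg (fun M => a • M) hX
    simp only [smul_add, Matrix.mul_smul, Matrix.smul_mul, smul_smul, mul_inv_cancel₀ hα,
      mul_inv_cancel_left₀ hα, one_smul, smul_zero] at h1
    simp only [Matrix.mul_add, Matrix.smul_mul, Matrix.mul_smul, Matrix.one_mul, hW]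
    rw [← sub_eq_zero, ← h1, ha]
    simp only [Matrix.mul_assoc]
    module

/-! ### The rank-`k` numerical range -/

theorem corollary2p4 (n r : ℕ) (hr : 0 < r) (hrn : r < n) (hn : n ≤ 2 * r)
    (α β : ℂ) (C : Matrix (Fin r) (Fin (n - r)) ℂ) (D : Matrix (Fin (n - r)) (Fin r) ℂ)
    (hnormal : IsStarNormal (D * C))
    (hcomm : Commute (D * C) (Cᴴ * C + D * Dᴴ))
    -- a simultaneous unitary diagonalization, which labels the eigenvalues
    (U : Matrix (Fin (n - r)) (Fin (n - r)) ℂ)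
    (hU : U ∈ Matrix.unitaryGroup (Fin (n - r)) ℂ)
    (z : Fin (n - r) → ℂ) (h : Fin (n - r) → ℝ)
    (hz : Uᴴ * (D * C) * U = Matrix.diagonal z)
    (hh : Uᴴ * (Cᴴ * C + D * Dᴴ) * U = Matrix.diagonal fun j => (h j : ℂ))
    (hnested : ∀ i j : Fin (n - r), i ≤ j →
      blockDisc α β (z j) (h j) ⊆ blockDisc α β (z i) (h i)) :
    ∀ k : Fin (n - r),
      rankNumericalRange (k.val + 1)
        (Matrix.fromBlocks (α • (1 : Matrix (Fin r) (Fin r) ℂ)) C D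
          (β • (1 : Matrix (Fin (n - r)) (Fin (n - r)) ℂ))) =
      blockDisc α β (z k) (h k) := by
  intro k
  have hzh := two_mul_norm_le_of_diagonalized hz hh
  have hh0 (j : Fin (n - r)) : 0 ≤ h j := le_trans (by positivity) (hzh j)
  apply Set.Subset.antisymm
  · intro c hc
    rw [mem_blockDisc_iff _ _ _ _ (hh0 k)]
    exact norm_sub_le_of_mem_rankNumericalRange hU hz hh k (hzh k)
      (fun j hj => norm_sub_le_of_blockDisc_subset (hzh j) (hh0 k) (hnested k j hj)) hc
  · intro c hc
    set ι : Fin (k.val + 1) → Fin (n - r) := Fin.castLE k.isLt with hι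
    have hinj : Function.Injective ι := Fin.castLE_injective _
    set W := U.submatrix id ι with hW
    have hsub (M : Matrix (Fin (n - r)) (Fin (n - r)) ℂ) :
        Wᴴ * M * W = (Uᴴ * M * U).submatrix ι ι := by
      rw [hW, Matrix.conjTranspose_submatrix]
      rfl
    have := mem_rankNumericalRange_fromBlocks (α := α) (β := β) (C := C) (D := D) (W := W)
      (Fin.castLEEmb (by omega : k.val + 1 ≤ r)) (z := z ∘ ι) (h := h ∘ ι) (c := c)
      (by
        have := hsub 1
        rw [Matrix.mul_one, Matrix.mul_one] at this
        rw [this, ← Matrix.star_eq_conjTranspose, Matrix.mem_unitaryGroup_iff'.1 hU,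
          Matrix.submatrix_one _ hinj])
      (by rw [hsub, hz, Matrix.submatrix_diagonal _ _ hinj])
      (by rw [hsub, hh, Matrix.submatrix_diagonal _ _ hinj]; rfl)
      (fun j => (mem_blockDisc_iff _ _ _ _ (hh0 _)).1 (hnested _ _ (by
        rw [hι, Fin.le_def, Fin.val_castLE]; omega) hc))
    rwa [Fintype.card_fin] at this
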